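/- Let $\Gamma$ be a finite distance-regular graph with classical parameters $(D,b,\alpha,\beta)$, where $b\ge 2$, $1\le\alpha\le b-1$ and $D\ge 3$; that is, $\Gamma$ is connected of diameter $D$ with intersection numbers $b_i=([D]-[i])(\beta-\alpha[i])$ for $0\le i\le D-1$ and $c_i=[i](1+\alpha[i-1])$ for $1\le i\le D$, where $[j]=\frac{b^j-1}{b-1}$. Put $r=[D]$. A Delsarte clique of $\Gamma$ is a clique with exactly $1+\frac{k}{-\theta_{\min}}$ vertices, where $k$ is the valency and $\theta_{\min}$ the smallest eigenvalue of the adjacency matrix of $\Gamma$. Assume that $\Gamma$ is geometric, i.e. there is a set of Delsarte cliques such that each edge lies in exactly one of them. Let $\mathcal C$ be a set of Delsarte cliques of $\Gamma$ (called lines) such that $(V(\Gamma),\mathcal C,\in)$ is a partial linear space (any two distinct vertices are on at most one common line) with point graph $\Gamma$ (two distinct vertices are adjacent if and only if they are on a common line). Assume the dual Pasch axiom: for any two adjacent vertices $x,y$, the common neighbours of $x$ and $y$ that are not on the line through $x$ and $y$ form a clique. An assembly is a maximal clique of $\Gamma$ that is not in $\mathcal C$. Then: 1. If a line $\ell\in\mathcal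 C$ and an assembly $M$ intersect, then $|\ell\cap M|=\alpha+1$. 2. If $M$ is an assembly and $u\notin M$ is a vertex that has a neighbour in $M$, then $u$ has exactly $\alpha+1$ neighbours in $M$, and there is exactly one line through $u$ that intersects $M$. 3. Consequently, $\alpha$, $\beta/\alpha$ and $r$ are integers, and for every vertex $x$ of $\Gamma$ the local graph at $x$ (the subgraph induced on the neighbours of $x$) is isomorphic to the $\alpha$-clique extension of the $\frac{\beta}{\alpha}\times r$-grid. Here the $m\times n$-grid is the Cartesian product $K_m\,\Box\,K_n$, and the $s$-clique extension of a graph replaces each vertex by a complete graph on $s$ vertices, two vertices from different such complete graphs being adjacent if and only if the replaced vertices are adjacent. -/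

import Mathlib

namespace ClassicalDRG

/-- The number `[j] = 1 + b + ⋯ + b^(j-1)`, which is `(b^j - 1)/(b - 1)` for `b ≠ 1`
and `j` for `b = 1`. -/
noncomputable def gaussNum (b : ℝ) (j : ℕ) : ℝ := ∑ i ∈ Finset.range j, b ^ i

variable {V : Type*}

/-- `G` is a (connected) distance-regular graph with intersection numbers `bs i`, `cs i`: for any
vertices `x`, `y` at distance `i`, exactly `cs i` neighbours of `y` are at distance `i - 1` from `x`
and exactly `bs i` neighbours of `y` are at distance `i + 1` from `x`. -/
structure IsDistanceRegularWith (G : SimpleGraph V) (bs cs : ℕ → ℕ) : Prop where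
  connected : G.Connected
  card_c : ∀ (i : ℕ) (x y : V), G.dist x y = i →
    {z : V | G.Adj y z ∧ G.dist x z + 1 = i}.ncard = cs i
  card_b : ∀ (i : ℕ) (x y : V), G.dist x y = i →
    {z : V | G.Adj y z ∧ G.dist x z = i + 1}.ncard = bs i

/-- `G` is distance-regular. -/
def IsDistanceRegular (G : SimpleGraph V) : Prop :=
  ∃ bs cs : ℕ → ℕ, IsDistanceRegularWith G bs cs

/-- `G` is a distance-regular graph with classical parameters `(D, b, α, β)`. -/
def HasClassicalParameters (G : SimpleGraph V) (D : ℕ) (b α β : ℝ) : Prop :=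
  ∃ bs cs : ℕ → ℕ, IsDistanceRegularWith G bs cs ∧ G.diam = D ∧
    (∀ i : ℕ, i < D →
      (bs i : ℝ) = (gaussNum b D - gaussNum b i) * (β - α * gaussNum b i)) ∧
    (∀ i : ℕ, 1 ≤ i → i ≤ D →
      (cs i : ℝ) = gaussNum b i * (1 + α * gaussNum b (i - 1)))

/-- `θ` is the smallest eigenvalue of the adjacency matrix of `G`. -/
def IsSmallestEigenvalue [Fintype V] [DecidableEq V] (G : SimpleGraph V) [DecidableRel G.Adj]
    (θ : ℝ) : Prop :=
  IsLeast {μ : ℝ | Module.End.HasEigenvalue (Matrix.toLin' (G.adjMatrix ℝ)) μ} θ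

/-- A Delsarte clique of a regular graph with valency `k` and smallest eigenvalue `θ`: a clique
with exactly `1 + k / (-θ)` vertices. -/
def IsDelsarteClique [Fintype V] [DecidableEq V] (G : SimpleGraph V) [DecidableRel G.Adj]
    (C : Set V) : Prop :=
  G.IsClique C ∧ ∃ (k : ℕ) (θ : ℝ), G.IsRegularOfDegree k ∧ IsSmallestEigenvalue G θ ∧
    (C.ncard : ℝ) = 1 + k / (-θ)

/-- A distance-regular graph is geometric if there is a set of Delsarte cliques such that each
edge lies in exactly one of them. -/
def IsGeometric [Fintype V] [DecidableEq V] (G : SimpleGraph V) [DecidableRel G.Adj] : Prop :=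
  IsDistanceRegular G ∧ ∃ 𝓒 : Set (Set V), (∀ C ∈ 𝓒, IsDelsarteClique G C) ∧
    ∀ x y : V, G.Adj x y → ∃! C : Set V, C ∈ 𝓒 ∧ x ∈ C ∧ y ∈ C

/-- `(V, 𝓛, ∈)` is a partial linear space: there are points and lines, and any two distinct points
are on at most one common line. -/
structure IsPartialLinearSpace (𝓛 : Set (Set V)) : Prop where
  points_nonempty : Nonempty V
  lines_nonempty : 𝓛.Nonempty
  line_unique : ∀ x y : V, x ≠ y → ∀ ℓ ∈ 𝓛, ∀ m ∈ 𝓛, x ∈ ℓ → y ∈ ℓ → x ∈ m → y ∈ m → ℓ = m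

/-- `G` is the point graph of `(V, 𝓛, ∈)`: adjacent means distinct and on a common line. -/
def IsPointGraph (G : SimpleGraph V) (𝓛 : Set (Set V)) : Prop :=
  ∀ x y : V, G.Adj x y ↔ x ≠ y ∧ ∃ ℓ ∈ 𝓛, x ∈ ℓ ∧ y ∈ ℓ

/-- The dual Pasch axiom: for adjacent `x`, `y`, the common neighbours of `x` and `y` outside the
line through `x` and `y` form a clique. -/
def DualPasch (G : SimpleGraph V) (𝓛 : Set (Set V)) : Prop :=
  ∀ x y : V, G.Adj x y → ∀ ℓ ∈ 𝓛, x ∈ ℓ → y ∈ ℓ →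
    G.IsClique {z : V | G.Adj x z ∧ G.Adj y z ∧ z ∉ ℓ}

/-- An assembly: a maximal clique that is not a line. -/
def IsAssembly (G : SimpleGraph V) (𝓛 : Set (Set V)) (M : Set V) : Prop :=
  Maximal (fun C : Set V => G.IsClique C) M ∧ M ∉ 𝓛

/-- The local graph of `G` at `x`: the subgraph induced on the neighbours of `x`. -/
def localGraph (G : SimpleGraph V) (x : V) : SimpleGraph (G.neighborSet x) :=
  G.induce (G.neighborSet x)

/-- The `s`-clique extension of `G`: each vertex is replaced by a complete graph on `s` vertices,
and vertices of different complete graphs are adjacent iff the replaced vertices are. -/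
def cliqueExtension (s : ℕ) (G : SimpleGraph V) : SimpleGraph (V × Fin s) where
  Adj p q := G.Adj p.1 q.1 ∨ (p.1 = q.1 ∧ p.2 ≠ q.2)
  symm := ⟨fun _ _ h => h.imp (fun h => h.symm) (fun h => ⟨h.1.symm, h.2.symm⟩)⟩
  loopless := ⟨fun _ h => h.elim (fun h => h.ne rfl) (fun h => h.2 rfl)⟩

/-- The `m × n`-grid: the Cartesian product of complete graphs on `m` and on `n` vertices. -/
def grid (m n : ℕ) : SimpleGraph (Fin m × Fin n) :=
  SimpleGraph.boxProd (⊤ : SimpleGraph (Fin m)) (⊤ : SimpleGraph (Fin n))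

end ClassicalDRG

set_option linter.unusedSectionVars false

namespace ClassicalDRG

open Finset

/-! The smallest eigenvalue is `-[D]`, so Delsarte cliques have `1 + β` vertices
(`ncard_delsarteClique`) and every vertex is on `[D]` lines (`ncard_lines`). If `N` is the
point-line incidence matrix and `A` the adjacency matrix, then `N Nᵀ = A + [D] I`, so eigenvectors
for `-[D]` sum to zero on each line (`sum_line_eq_zero`). For the cosine vector centred at a point
off a line with a neighbour on it, this forces exactly `α + 1` neighbours on that line
(`ncard_neighbors_on_line`).

What remains is incidence geometry (`IsDualPaschGeometry` with `s = α`, `r = [D] ≥ 3`). The dual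
Pasch axiom and a third line through each point show that an assembly containing two vertices of a
triangle with no two sides on a common line contains the third (`mem_of_isTriangle`); the claims on
assemblies follow. The neighbours of `x` are partitioned by lines and by an equivalence recording
assemblies. Each line meets each class in `s` points (`card_fiber`), and adjacency means sharing a
line or a class (`adj_iff`): this is the extended grid. Counting the `rβ` neighbours gives `β/α`
classes. -/

theorem gaussNum_zero (b : ℝ) : gaussNum b 0 = 0 := by simp [gaussNum]

theorem gaussNum_one (b : ℝ) : gaussNum b 1 = 1 := by simp [gaussNum]

theorem gaussNum_succ (b : ℝ) (j : ℕ) : gaussNum b (j + 1) = gaussNum b j + b ^ j :=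
  Finset.sum_range_succ _ _

theorem gaussNum_strictMono {b : ℝ} (hb : 0 < b) : StrictMono (gaussNum b) :=
  strictMono_nat_of_lt_succ fun j => by
    rw [gaussNum_succ]; linarith [pow_pos hb j]

theorem gaussNum_nonneg {b : ℝ} (hb : 0 < b) (j : ℕ) : 0 ≤ gaussNum b j :=
  Finset.sum_nonneg fun _ _ => (pow_pos hb _).le

/-! ### Distance-regular graphs: the intersection matrix and sphere sums. -/

section DistanceRegular

variable {V : Type*} [Fintype V] [DecidableEq V] {G : SimpleGraph V} [DecidableRel G.Adj]
  {bs cs : ℕ → ℕ}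

theorem IsDistanceRegularWith.degree_eq (h : IsDistanceRegularWith G bs cs) (y : V) :
    G.degree y = bs 0 := by
  rw [← h.card_b 0 y y (by simp), ← G.card_neighborFinset_eq_degree, ← Set.ncard_coe_finset]
  congr 1
  ext z
  simp [SimpleGraph.dist_eq_one_iff_adj]

theorem IsDistanceRegularWith.dist_cases (h : IsDistanceRegularWith G bs cs) (x : V) {y z : V}
    (hyz : G.Adj y z) : G.dist x z = G.dist x y ∨ G.dist x z + 1 = G.dist x y ∨
      G.dist x z = G.dist x y + 1 := by
  have h1 := h.connected.dist_triangle (u := x) (v := y) (w := z)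
  have h2 := h.connected.dist_triangle (u := x) (v := z) (w := y)
  rw [SimpleGraph.dist_eq_one_iff_adj.2 hyz] at h1
  rw [SimpleGraph.dist_eq_one_iff_adj.2 hyz.symm] at h2
  omega

/-- The adjacency operator acts on functions of the distance from `x` by the tridiagonal
intersection matrix. -/
theorem IsDistanceRegularWith.sum_neighborFinset (h : IsDistanceRegularWith G bs cs)
    (w : ℕ → ℝ) (x y : V) :
    ∑ z ∈ G.neighborFinset y, w (G.dist x z) =
      bs 0 * w (G.dist x y) + cs (G.dist x y) * (w (G.dist x y - 1) - w (G.dist x y)) +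
        bs (G.dist x y) * (w (G.dist x y + 1) - w (G.dist x y)) := by
  set j := G.dist x y with hj
  have hc : ((#{z ∈ G.neighborFinset y | G.dist x z + 1 = j} : ℕ) : ℝ) = cs j := by
    rw [← h.card_c j x y hj.symm, ← Set.ncard_coe_finset]
    congr 2
    ext z
    simp
  have hb : ((#{z ∈ G.neighborFinset y | G.dist x z = j + 1} : ℕ) : ℝ) = bs j := by
    rw [← h.card_b j x y hj.symm, ← Set.ncard_coe_finset]
    congr 2
    ext z
    simp
  have key : ∀ z ∈ G.neighborFinset y, w (G.dist x z) =
      w j + (if G.dist x z + 1 = j then w (j - 1) - w j else 0) +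
        (if G.dist x z = j + 1 then w (j + 1) - w j else 0) := by
    intro z hz
    rcases h.dist_cases x ((G.mem_neighborFinset y z).1 hz) with e | e | e
    · rw [← hj] at e
      simp [e]
    · rw [← hj] at e
      rw [if_pos e, if_neg (by omega), ← e]
      simp
    · rw [← hj] at e
      rw [if_neg (by omega), if_pos e, e]
      simp
  rw [Finset.sum_congr rfl key, Finset.sum_add_distrib, Finset.sum_add_distrib,
    ← Finset.sum_filter, ← Finset.sum_filter, Finset.sum_const, Finset.sum_const,
    Finset.sum_const, nsmul_eq_mul, nsmul_eq_mul, nsmul_eq_mul, hc, hb,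
    G.card_neighborFinset_eq_degree, h.degree_eq]

theorem IsDistanceRegularWith.cs_zero (h : IsDistanceRegularWith G bs cs) : cs 0 = 0 := by
  obtain ⟨x⟩ := h.connected.nonempty
  rw [← h.card_c 0 x x (by simp)]
  simp

theorem exists_eigenvector {μ : ℝ}
    (hμ : Module.End.HasEigenvalue (Matrix.toLin' (G.adjMatrix ℝ)) μ) :
    ∃ f : V → ℝ, f ≠ 0 ∧ ∀ y, ∑ z ∈ G.neighborFinset y, f z = μ * f y := by
  obtain ⟨f, hf⟩ := hμ.exists_hasEigenvector
  refine ⟨f, hf.2, fun y => ?_⟩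
  have := congrFun hf.apply_eq_smul y
  rw [Matrix.toLin'_apply, SimpleGraph.adjMatrix_mulVec_apply] at this
  simpa using this

theorem hasEigenvalue_of_eigenvector {μ : ℝ} {f : V → ℝ} (hf : f ≠ 0)
    (h : ∀ y, ∑ z ∈ G.neighborFinset y, f z = μ * f y) :
    Module.End.HasEigenvalue (Matrix.toLin' (G.adjMatrix ℝ)) μ := by
  refine Module.End.hasEigenvalue_of_hasEigenvector (x := f) ⟨?_, hf⟩
  rw [Module.End.mem_eigenspace_iff]
  funext y
  rw [Matrix.toLin'_apply, SimpleGraph.adjMatrix_mulVec_apply, h y]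
  simp

/-- The sum of `f` over the vertices at distance `j` from `x`. -/
noncomputable def sphereSum (G : SimpleGraph V) (f : V → ℝ) (x : V) (j : ℕ) : ℝ :=
  ∑ z, if G.dist x z = j then f z else 0

theorem sphereSum_zero (h : IsDistanceRegularWith G bs cs) (f : V → ℝ) (x : V) :
    sphereSum G f x 0 = f x := by
  simp [sphereSum, h.connected.dist_eq_zero_iff]

theorem sphereSum_one (f : V → ℝ) (x : V) :
    sphereSum G f x 1 = ∑ z ∈ G.neighborFinset x, f z := by
  rw [sphereSum, ← Finset.sum_filter]
  congr 1
  ext z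
  simp [SimpleGraph.dist_eq_one_iff_adj]

/-- Sum the eigenvalue equation over the sphere of radius `j + 1` and exchange the sums: each `z`
contributes `f z` times its number of neighbours on that sphere, which `sum_neighborFinset` gives
for an indicator weight. -/
theorem IsDistanceRegularWith.sphereSum_rec (h : IsDistanceRegularWith G bs cs) {f : V → ℝ}
    {θ : ℝ} (hf : ∀ y, ∑ z ∈ G.neighborFinset y, f z = θ * f y) (x : V) (j : ℕ) :
    θ * sphereSum G f x (j + 1) = (bs 0 - bs (j + 1) - cs (j + 1)) * sphereSum G f x (j + 1) +
      cs (j + 2) * sphereSum G f x (j + 2) + bs j * sphereSum G f x j := by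
  have e1 : θ * sphereSum G f x (j + 1) =
      ∑ y, ∑ z ∈ G.neighborFinset y, if G.dist x y = j + 1 then f z else 0 := by
    rw [sphereSum, Finset.mul_sum]
    refine Finset.sum_congr rfl fun y _ => ?_
    split_ifs
    · rw [hf]
    · simp
  have e2 : ∑ y, ∑ z ∈ G.neighborFinset y, (if G.dist x y = j + 1 then f z else 0) =
      ∑ z, ∑ y ∈ G.neighborFinset z, if G.dist x y = j + 1 then f z else 0 :=
    Finset.sum_comm' fun y z => by simp [G.adj_comm]
  have e3 : ∀ z, ∑ y ∈ G.neighborFinset z, (if G.dist x y = j + 1 then f z else 0) =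
      (bs 0 - bs (j + 1) - cs (j + 1)) * (if G.dist x z = j + 1 then f z else 0) +
      cs (j + 2) * (if G.dist x z = j + 2 then f z else 0) +
      bs j * (if G.dist x z = j then f z else 0) := by
    intro z
    have := h.sum_neighborFinset (fun i => if i = j + 1 then f z else 0) x z
    rw [this]
    generalize G.dist x z = i
    by_cases h1 : i = j + 1
    · subst h1
      simp
      ring
    · by_cases h2 : i = j + 2
      · subst h2
        simp
      · by_cases h3 : i = j
        · subst h3
          simp
        · have : ¬ (i - 1 = j + 1) := by omega
          simp [h1, h2, h3, this]
  rw [e1, e2, Finset.sum_congr rfl fun z _ => e3 z]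
  simp only [sphereSum, Finset.sum_add_distrib, Finset.mul_sum]

end DistanceRegular

/-! ### Classical intersection numbers and their boundary values. -/

section ClassicalParameters

variable {V : Type*} [Fintype V] [DecidableEq V] {G : SimpleGraph V} [DecidableRel G.Adj]
  {bs cs : ℕ → ℕ} {D : ℕ} {b α β : ℝ}

theorem dist_le_of_diam (hc : G.Connected) (hd : G.diam = D) (x y : V) : G.dist x y ≤ D := by
  have := hc.nonempty
  exact hd ▸ SimpleGraph.dist_le_diam (SimpleGraph.connected_iff_ediam_ne_top.1 hc)

theorem exists_dist_eq (hc : G.Connected) (hd : G.diam = D) {j : ℕ} (hj : j ≤ D) :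
    ∃ x y : V, G.dist x y = j := by
  have := hc.nonempty
  obtain ⟨x, y, hxy⟩ := G.exists_dist_eq_diam
  obtain ⟨p, hp⟩ := hc.exists_walk_length_eq_dist x y
  refine ⟨x, p.getVert j, ?_⟩
  have h1 : G.dist x (p.getVert j) ≤ j :=
    (SimpleGraph.dist_le (p.take j)).trans (by simp)
  have h2 : G.dist (p.getVert j) y ≤ D - j :=
    (SimpleGraph.dist_le (p.drop j)).trans (by simp; omega)
  have h3 := hc.dist_triangle (u := x) (v := p.getVert j) (w := y)
  omega

/-- The intersection numbers of a graph with classical parameters, with the boundary values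
included. -/
structure ClassicalNumbers (G : SimpleGraph V) (bs cs : ℕ → ℕ) (D : ℕ) (b α β : ℝ) : Prop where
  reg : IsDistanceRegularWith G bs cs
  dist_le : ∀ x y, G.dist x y ≤ D
  exists_dist : ∀ j ≤ D, ∃ x y, G.dist x y = j
  b_eq : ∀ j ≤ D, (bs j : ℝ) = (gaussNum b D - gaussNum b j) * (β - α * gaussNum b j)
  c_eq : ∀ j < D, (cs (j + 1) : ℝ) = gaussNum b (j + 1) * (1 + α * gaussNum b j)
  b_pos : ∀ j < D, 0 < bs j

theorem HasClassicalParameters.exists_numbers (hG : HasClassicalParameters G D b α β) :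
    ∃ bs cs, ClassicalNumbers G bs cs D b α β := by
  obtain ⟨bs, cs, h, hd, hb, hc⟩ := hG
  refine ⟨bs, cs, h, dist_le_of_diam h.connected hd, fun j => exists_dist_eq h.connected hd,
    fun j hj => ?_, fun j hj => hc (j + 1) (by omega) hj, fun j hj => ?_⟩
  · rcases hj.lt_or_eq with h1 | rfl
    · exact hb j h1
    -- For `j = D` the formula gives `0`, and indeed no vertex is at distance `D + 1`.
    · obtain ⟨x, y, hxy⟩ := exists_dist_eq h.connected hd le_rfl
      rw [sub_self, zero_mul, ← h.card_b j x y hxy, Nat.cast_eq_zero, Set.ncard_eq_zero]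
      ext z
      have := dist_le_of_diam h.connected hd x z
      simp
      omega
  -- The vertex `y` next to `z` on a geodesic to `x` is at distance `j` from `x`, and `z` is counted
  -- by `bs j`.
  · obtain ⟨x, z, hxz⟩ := exists_dist_eq h.connected hd (j := j + 1) hj
    obtain ⟨p, hp⟩ := h.connected.exists_walk_length_eq_dist z x
    cases p with
    | nil => simp at hxz
    | @cons _ y _ hzy q =>
      have h1 := h.dist_cases x hzy
      have h2 : G.dist x y ≤ j := by
        rw [G.dist_comm]
        refine (SimpleGraph.dist_le q).trans ?_
        rw [SimpleGraph.Walk.length_cons, G.dist_comm, hxz] at hp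
        omega
      rw [← h.card_b j x y (by omega), Set.ncard_pos]
      exact ⟨z, hzy.symm, hxz⟩

end ClassicalParameters

end ClassicalDRG
namespace ClassicalDRG

open Finset

/-! ### The smallest eigenvalue is `-[D]`. -/

section Spectrum

variable {V : Type*} [Fintype V] [DecidableEq V] {G : SimpleGraph V} [DecidableRel G.Adj]
  {bs cs : ℕ → ℕ} {D : ℕ} {b α β : ℝ}

theorem ClassicalNumbers.sub_pos (h : ClassicalNumbers G bs cs D b α β) (hb : 0 < b) {j : ℕ}
    (hj : j < D) : 0 < β - α * gaussNum b j := by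
  have h1 : (0 : ℝ) < bs j := by exact_mod_cast h.b_pos j hj
  rw [h.b_eq j hj.le] at h1
  exact pos_of_mul_pos_right h1 (sub_nonneg.2 ((gaussNum_strictMono hb).monotone hj.le))

/-- No eigenvalue of a graph with classical parameters is smaller than `-[D]`. -/
theorem ClassicalNumbers.neg_gaussNum_le (h : ClassicalNumbers G bs cs D b α β) (hb : 0 < b)
    (hα : 0 ≤ α) (hD : 0 < D) {θ : ℝ}
    (hθ : Module.End.HasEigenvalue (Matrix.toLin' (G.adjMatrix ℝ)) θ) :
    -gaussNum b D ≤ θ := by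
  by_contra! hlt
  obtain ⟨f, hf0, hf⟩ := exists_eigenvector hθ
  obtain ⟨x, hx⟩ := Function.ne_iff.1 hf0
  have hx : f x ≠ 0 := hx
  have hmono := gaussNum_strictMono hb
  -- For `θ = -[D]` the second relation in `key` would be an equality; a smaller `θ` makes the
  -- signed sphere sums grow strictly faster.
  let P : ℕ → ℝ := fun j => (-1) ^ j * sphereSum G f x j * f x
  have key : ∀ j ≤ D, 0 < P j ∧
      (gaussNum b D - gaussNum b j) * (1 + α * gaussNum b j) * P j < cs (j + 1) * P (j + 1) := by
    intro j
    induction j with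
    | zero =>
      intro _
      have h0 : P 0 = f x * f x := by simp [P, sphereSum_zero h.reg]
      have h1 : P 1 = -θ * (f x * f x) := by
        simp only [P]
        rw [sphereSum_one, hf x]
        ring
      have hpos : 0 < f x * f x := mul_self_pos.2 hx
      refine ⟨h0 ▸ hpos, ?_⟩
      rw [zero_add, h0, h1, h.c_eq 0 hD, gaussNum_zero, gaussNum_one]
      nlinarith
    | succ j ih =>
      intro hj
      obtain ⟨hP, hlt'⟩ := ih (by omega)
      have hg : 0 < 1 + α * gaussNum b j := by
        have := mul_nonneg hα (gaussNum_nonneg hb j)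
        linarith
      have hjD : 0 < gaussNum b D - gaussNum b j := _root_.sub_pos.2 (hmono (by omega))
      have hP1 : 0 < P (j + 1) :=
        pos_of_mul_pos_right ((mul_pos (mul_pos hjD hg) hP).trans hlt') (Nat.cast_nonneg _)
      refine ⟨hP1, ?_⟩
      rw [h.c_eq j (by omega)] at hlt'
      -- After cancelling `1 + α[j]`, multiplying by `β - α[j]` turns the left side into `bs j * P
      -- j`, the term subtracted in `hrec`.
      have hlt2 : (gaussNum b D - gaussNum b j) * P j < gaussNum b (j + 1) * P (j + 1) := by
        refine lt_of_mul_lt_mul_left ?_ hg.le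
        linarith
      have hlt3 := mul_lt_mul_of_pos_left hlt2 (h.sub_pos hb (j := j) (by omega))
      have hrec : cs (j + 2) * P (j + 2) =
          (bs 0 - bs (j + 1) - cs (j + 1) - θ) * P (j + 1) - bs j * P j := by
        have := h.reg.sphereSum_rec hf x j
        simp only [P, pow_succ]
        linear_combination (-1) ^ j * f x * (-this)
      have hθP := mul_lt_mul_of_pos_right (neg_lt_neg hlt) hP1
      rw [show j + 1 + 1 = j + 2 from rfl, hrec, h.b_eq 0 (Nat.zero_le _), h.b_eq (j + 1) hj,
        h.c_eq j (by omega), h.b_eq j (by omega), gaussNum_zero]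
      linarith
  -- At `j = D` the left side vanishes, and so does the right, whatever `cs (D + 1)` is, because the
  -- sphere of radius `D + 1` is empty.
  have hlast := (key D le_rfl).2
  have hz : P (D + 1) = 0 := by
    have : sphereSum G f x (D + 1) = 0 := Finset.sum_eq_zero fun z _ => by
      have := h.dist_le x z
      rw [if_neg (by omega)]
    simp [P, this]
  rw [hz] at hlast
  simp at hlast

/-- The cosine sequence of the eigenvalue `-[D]`. -/
noncomputable def minCosine (b α β : ℝ) (j : ℕ) : ℝ :=
  ∏ i ∈ Finset.range j, -((1 + α * gaussNum b i) / (β - α * gaussNum b i))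

theorem minCosine_succ (b α β : ℝ) (j : ℕ) : minCosine b α β (j + 1) =
    minCosine b α β j * -((1 + α * gaussNum b j) / (β - α * gaussNum b j)) :=
  Finset.prod_range_succ _ _

theorem ClassicalNumbers.sum_minCosine (h : ClassicalNumbers G bs cs D b α β) (hb : 0 < b)
    (x y : V) : ∑ z ∈ G.neighborFinset y, minCosine b α β (G.dist x z) =
      -gaussNum b D * minCosine b α β (G.dist x y) := by
  rw [h.reg.sum_neighborFinset]
  have hj := h.dist_le x y
  generalize G.dist x y = j at hj
  -- At `j = D` the denominator `β - α[D]` in the next cosine may be zero, but both sides carry the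
  -- factor `[D] - [D]`.
  have hbs : ∀ j ≤ D, bs j * minCosine b α β (j + 1) =
      -((gaussNum b D - gaussNum b j) * (1 + α * gaussNum b j)) * minCosine b α β j := by
    intro j hj
    rw [h.b_eq j hj]
    rcases hj.lt_or_eq with h1 | rfl
    · have := mul_div_cancel₀ (1 + α * gaussNum b j) (h.sub_pos hb h1).ne'
      rw [minCosine_succ]
      linear_combination -(gaussNum b D - gaussNum b j) * minCosine b α β j * this
    · ring
  have h0 := h.b_eq 0 (Nat.zero_le _)
  rw [gaussNum_zero] at h0
  have h1 := hbs j hj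
  have h2 := h.b_eq j hj
  cases j with
  | zero =>
    -- This removes the term with the truncated index `0 - 1`.
    rw [h.reg.cs_zero]
    rw [gaussNum_zero] at h1
    linear_combination h1
  | succ j =>
    have hc := h.c_eq j (by omega)
    have h3 : cs (j + 1) * minCosine b α β j =
        -(gaussNum b (j + 1) * (β - α * gaussNum b j)) * minCosine b α β (j + 1) := by
      have := (h.sub_pos hb (j := j) (by omega)).ne'
      rw [hc, minCosine_succ]
      field_simp
    rw [Nat.add_sub_cancel]
    linear_combination h1 + h3 + minCosine b α β (j + 1) * (h0 - h2 - hc)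

theorem ClassicalNumbers.isSmallestEigenvalue (h : ClassicalNumbers G bs cs D b α β) (hb : 0 < b)
    (hα : 0 ≤ α) (hD : 0 < D) : IsSmallestEigenvalue G (-gaussNum b D) := by
  refine ⟨?_, fun θ hθ => h.neg_gaussNum_le hb hα hD hθ⟩
  obtain ⟨x⟩ := h.reg.connected.nonempty
  refine hasEigenvalue_of_eigenvector (f := fun y => minCosine b α β (G.dist x y)) ?_
    (h.sum_minCosine hb x)
  refine Function.ne_iff.2 ⟨x, ?_⟩
  simp [minCosine]

theorem ClassicalNumbers.ncard_delsarteClique (h : ClassicalNumbers G bs cs D b α β) (hb : 0 < b)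
    (hα : 0 ≤ α) (hD : 0 < D) {C : Set V} (hC : IsDelsarteClique G C) :
    (C.ncard : ℝ) = 1 + β := by
  obtain ⟨-, k, θ, hk, hθ, hcard⟩ := hC
  obtain ⟨x⟩ := h.reg.connected.nonempty
  have hkb : (k : ℝ) = gaussNum b D * β := by
    rw [← hk.degree_eq x, h.reg.degree_eq, h.b_eq 0 (Nat.zero_le _), gaussNum_zero]
    ring
  have hpos : 0 < gaussNum b D := gaussNum_zero b ▸ gaussNum_strictMono hb hD
  rw [hcard, hθ.unique (h.isSmallestEigenvalue hb hα hD), hkb, neg_neg,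
    mul_div_cancel_left₀ _ hpos.ne']

end Spectrum

/-! ### Eigenvectors for the smallest eigenvalue on lines. -/

section LineSums

variable {V : Type*} [Fintype V] [DecidableEq V] {G : SimpleGraph V} [DecidableRel G.Adj]
  {𝓒 : Set (Set V)}

theorem ncard_lines_through_pair (hPLS : IsPartialLinearSpace 𝓒) (hpt : IsPointGraph G 𝓒)
    {x y : V} (hxy : x ≠ y) :
    {ℓ ∈ 𝓒 | x ∈ ℓ ∧ y ∈ ℓ}.ncard = if G.Adj x y then 1 else 0 := by
  split_ifs with hadj
  · obtain ⟨-, ℓ, hℓ, hx, hy⟩ := (hpt x y).1 hadj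
    rw [Set.ncard_eq_one]
    refine ⟨ℓ, Set.eq_singleton_iff_unique_mem.2 ⟨⟨hℓ, hx, hy⟩, ?_⟩⟩
    rintro m ⟨hm, hx', hy'⟩
    exact hPLS.line_unique x y hxy m hm ℓ hℓ hx' hy' hx hy
  · rw [Set.ncard_eq_zero]
    ext ℓ
    simp only [Set.mem_ofPred_eq, Set.mem_empty_iff_false, iff_false]
    rintro ⟨hℓ, hx, hy⟩
    exact hadj ((hpt x y).2 ⟨hxy, ℓ, hℓ, hx, hy⟩)

/-- Counting pairs of a neighbour and a line: each point is on `k / (|ℓ| - 1)` lines. -/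
theorem ncard_lines_mul (hPLS : IsPartialLinearSpace 𝓒) (hpt : IsPointGraph G 𝓒) {n : ℝ}
    (hn : ∀ ℓ ∈ 𝓒, (ℓ.ncard : ℝ) = 1 + n) (x : V) :
    ({ℓ ∈ 𝓒 | x ∈ ℓ}.ncard : ℝ) * n = G.degree x := by
  classical
  have hL : {ℓ ∈ 𝓒 | x ∈ ℓ} = ((univ.filter fun ℓ : Set V => ℓ ∈ 𝓒 ∧ x ∈ ℓ : Finset (Set V)) :
      Set (Set V)) := by ext; simp
  have h1 : ∀ ℓ : Set V, ℓ ∈ 𝓒 ∧ x ∈ ℓ → ∑ y : V, (if y ∈ ℓ ∧ x ≠ y then (1 : ℝ) else 0) = n := by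
    rintro ℓ ⟨hℓ, hx⟩
    have h2 : ((ℓ \ {x}).ncard : ℝ) = n := by
      have := Set.ncard_sdiff_singleton_add_one hx
      have h3 := hn ℓ hℓ
      rw [← this] at h3
      push_cast at h3
      linarith
    rw [← h2, ← Finset.sum_filter, Finset.sum_const, nsmul_eq_mul, mul_one,
      ← Set.ncard_coe_finset]
    congr 2
    ext y
    simp [eq_comm]
  have h2 : ∀ y : V, ∑ ℓ ∈ univ.filter (fun ℓ : Set V => ℓ ∈ 𝓒 ∧ x ∈ ℓ),
      (if y ∈ ℓ ∧ x ≠ y then (1 : ℝ) else 0) = if G.Adj x y then 1 else 0 := by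
    intro y
    by_cases hxy : x = y
    · subst hxy
      simp
    · have := ncard_lines_through_pair hPLS hpt hxy
      rw [← Finset.sum_filter, Finset.sum_const, nsmul_eq_mul, mul_one, ← Set.ncard_coe_finset,
        ← Nat.cast_one, ← Nat.cast_zero, ← Nat.cast_ite, ← this]
      congr 2
      ext ℓ
      simp [hxy, and_assoc]
  rw [hL, Set.ncard_coe_finset, ← nsmul_eq_mul, ← Finset.sum_const,
    ← Finset.sum_congr rfl fun ℓ hℓ => h1 ℓ (Finset.mem_filter.1 hℓ).2, Finset.sum_comm,
    Finset.sum_congr rfl fun y _ => h2 y, ← Finset.sum_filter, Finset.sum_const, nsmul_eq_mul,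
    mul_one, ← G.card_neighborFinset_eq_degree]
  congr 2
  ext y
  simp

open Classical in
/-- If each point is on `r` lines, eigenvectors for `-r` sum to zero on every line. -/
theorem sum_line_eq_zero (hPLS : IsPartialLinearSpace 𝓒) (hpt : IsPointGraph G 𝓒) {r : ℝ}
    (hr : ∀ x, ({ℓ ∈ 𝓒 | x ∈ ℓ}.ncard : ℝ) = r) {f : V → ℝ}
    (hf : ∀ y, ∑ z ∈ G.neighborFinset y, f z = -r * f y) {ℓ : Set V} (hℓ : ℓ ∈ 𝓒) :
    ∑ y, (if y ∈ ℓ then f y else 0) = 0 := by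
  -- The `(y, z)` entry of `N Nᵀ` counts the lines through both points.
  have hcount : ∀ y z : V, ∑ m ∈ univ.filter (fun m : Set V => m ∈ 𝓒),
      (if y ∈ m then f y else 0) * (if z ∈ m then f z else 0) =
        (if y = z then r else if G.Adj y z then 1 else 0) * (f y * f z) := by
    intro y z
    have h1 : ({m ∈ 𝓒 | y ∈ m ∧ z ∈ m}.ncard : ℝ) =
        if y = z then r else if G.Adj y z then 1 else 0 := by
      split_ifs with e ha
      · subst e
        simpa using hr y
      · rw [ncard_lines_through_pair hPLS hpt e, if_pos ha, Nat.cast_one]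
      · rw [ncard_lines_through_pair hPLS hpt e, if_neg ha, Nat.cast_zero]
    have h2 : ∀ m : Set V, (if y ∈ m then f y else 0) * (if z ∈ m then f z else 0) =
        if y ∈ m ∧ z ∈ m then f y * f z else 0 := by
      intro m
      by_cases e1 : y ∈ m <;> by_cases e2 : z ∈ m <;> simp [e1, e2]
    rw [Finset.sum_congr rfl fun m _ => h2 m, ← Finset.sum_filter, Finset.sum_const, nsmul_eq_mul,
      ← h1, ← Set.ncard_coe_finset]
    congr 3
    ext m
    simp
  -- The sum of squares is `fᵀ (A + r I) f`, which vanishes for the eigenvalue `-r`.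
  have hsq : ∑ m ∈ univ.filter (fun m : Set V => m ∈ 𝓒),
      (∑ y, if y ∈ m then f y else 0) ^ 2 = 0 := by
    simp_rw [sq, Finset.sum_mul_sum]
    rw [Finset.sum_comm]
    refine Finset.sum_eq_zero fun y _ => ?_
    rw [Finset.sum_comm, Finset.sum_congr rfl fun z _ => hcount y z]
    have : ∀ z, (if y = z then r else if G.Adj y z then 1 else 0) * (f y * f z) =
        (if y = z then r * (f y * f z) else 0) + f y * (if G.Adj y z then f z else 0) := by
      intro z
      by_cases e : y = z
      · subst e
        simp
      · by_cases e2 : G.Adj y z <;> simp [e, e2]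
    rw [Finset.sum_congr rfl fun z _ => this z, Finset.sum_add_distrib, ← Finset.mul_sum,
      ← Finset.sum_filter (fun z => G.Adj y z), ← SimpleGraph.neighborFinset_eq_filter, hf y]
    simp
    ring
  exact pow_eq_zero_iff (two_ne_zero) |>.1
    ((Finset.sum_eq_zero_iff_of_nonneg fun _ _ => sq_nonneg _).1 hsq ℓ (by simpa using hℓ))

end LineSums

/-! ### Neighbours of a point on a line. -/

section LineNeighbours

variable {V : Type*} [Fintype V] [DecidableEq V] {G : SimpleGraph V} [DecidableRel G.Adj]
  {bs cs : ℕ → ℕ} {D : ℕ} {b α β : ℝ} {𝓒 : Set (Set V)}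

theorem ClassicalNumbers.ncard_lines (h : ClassicalNumbers G bs cs D b α β) (hb : 0 < b)
    (hα : 0 ≤ α) (hD : 0 < D) (hDel : ∀ C ∈ 𝓒, IsDelsarteClique G C)
    (hPLS : IsPartialLinearSpace 𝓒) (hpt : IsPointGraph G 𝓒) (x : V) :
    ({ℓ ∈ 𝓒 | x ∈ ℓ}.ncard : ℝ) = gaussNum b D := by
  have h1 := ncard_lines_mul hPLS hpt (fun ℓ hℓ => h.ncard_delsarteClique hb hα hD (hDel ℓ hℓ)) x
  have hβ := h.sub_pos hb hD
  rw [h.reg.degree_eq, h.b_eq 0 (Nat.zero_le _), gaussNum_zero] at h1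
  rw [gaussNum_zero] at hβ
  simp only [mul_zero, sub_zero] at h1 hβ
  exact mul_right_cancel₀ hβ.ne' h1

/-- A point off a line with a neighbour on that line has exactly `α + 1` neighbours on it. -/
theorem ClassicalNumbers.ncard_neighbors_on_line (h : ClassicalNumbers G bs cs D b α β)
    (hb : 0 < b) (hα : 0 ≤ α) (hD : 1 < D) (hDel : ∀ C ∈ 𝓒, IsDelsarteClique G C)
    (hPLS : IsPartialLinearSpace 𝓒) (hpt : IsPointGraph G 𝓒) {ℓ : Set V} (hℓ : ℓ ∈ 𝓒) {u v : V}
    (hu : u ∉ ℓ) (hv : v ∈ ℓ) (huv : G.Adj u v) :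
    ({w ∈ ℓ | G.Adj u w}.ncard : ℝ) = α + 1 := by
  classical
  have hD0 : 0 < D := by omega
  have hsum := sum_line_eq_zero hPLS hpt
    (fun x => h.ncard_lines hb hα hD0 hDel hPLS hpt x) (h.sum_minCosine hb u) hℓ
  have hcard := h.ncard_delsarteClique hb hα hD0 (hDel ℓ hℓ)
  have hβ := h.sub_pos hb hD0
  have hβα := h.sub_pos hb hD
  rw [gaussNum_zero, mul_zero, sub_zero] at hβ
  rw [gaussNum_one, mul_one] at hβα
  set c := minCosine b α β with hc
  have hc1 : c 1 = -(1 / β) := by simp [hc, minCosine, gaussNum_zero]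
  have hc2 : c 2 = c 1 * -((1 + α) / (β - α)) := by
    rw [hc, minCosine_succ, gaussNum_one, mul_one]
  -- Since `ℓ` is a clique containing the neighbour `v`, its points are at distance `1` or `2` from
  -- `u`, so only `c 1` and `c 2` occur. With `n` neighbours on `ℓ`, the zero sum reads `n c 1 + (1
  -- + β - n) c 2 = 0`.
  have hdist : ∀ w, (if w ∈ ℓ then c (G.dist u w) else 0) =
      (if w ∈ ℓ then c 2 else 0) + (if w ∈ ℓ ∧ G.Adj u w then c 1 - c 2 else 0) := by
    intro w
    by_cases hw : w ∈ ℓ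
    · by_cases ha : G.Adj u w
      · simp [hw, ha, SimpleGraph.dist_eq_one_iff_adj.2 ha]
      · have hd0 : G.dist u w ≠ 0 := fun e => by
          rw [h.reg.connected.dist_eq_zero_iff] at e
          exact hu (e ▸ hw)
        have hd1 : G.dist u w ≠ 1 := fun e => ha (SimpleGraph.dist_eq_one_iff_adj.1 e)
        have hvw : G.Adj v w := (hDel ℓ hℓ).1 hv hw fun e => ha (e ▸ huv)
        have hd := h.reg.dist_cases u hvw
        rw [SimpleGraph.dist_eq_one_iff_adj.2 huv] at hd
        have hd2 : G.dist u w = 2 := by omega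
        simp [hw, ha, hd2]
    · simp [hw]
  have hn1 : ((#{w : V | w ∈ ℓ} : ℕ) : ℝ) = 1 + β := by
    rw [← hcard, ← Set.ncard_coe_finset]
    congr 2
    ext w
    simp
  have hn2 : ((#{w : V | w ∈ ℓ ∧ G.Adj u w} : ℕ) : ℝ) = ({w ∈ ℓ | G.Adj u w}.ncard : ℝ) := by
    rw [← Set.ncard_coe_finset]
    congr 2
    ext w
    simp
  rw [Finset.sum_congr rfl fun w _ => hdist w, Finset.sum_add_distrib, ← Finset.sum_filter,
    ← Finset.sum_filter, Finset.sum_const, Finset.sum_const, nsmul_eq_mul, nsmul_eq_mul, hn1, hn2,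
    hc2, hc1] at hsum
  field_simp at hsum
  have h3 : (1 + β) * (({w ∈ ℓ | G.Adj u w}.ncard : ℝ) - (α + 1)) = 0 := by
    linear_combination -hsum
  rcases mul_eq_zero.1 h3 with h4 | h4 <;> linarith

end LineNeighbours

end ClassicalDRG
-- Triangles, assemblies and local graphs of dual Pasch geometries.
namespace ClassicalDRG

/-- The local axioms of a dual Pasch geometry with `r` lines on each point, in which a point with a
neighbour on a line not through it has `s + 1` neighbours on that line. -/
structure IsDualPaschGeometry {V : Type*} (G : SimpleGraph V) (𝓒 : Set (Set V)) (s r : ℕ) :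
    Prop where
  isClique : ∀ ℓ ∈ 𝓒, G.IsClique ℓ
  line_unique : ∀ {x y : V}, x ≠ y → ∀ {ℓ m : Set V}, ℓ ∈ 𝓒 → m ∈ 𝓒 →
    x ∈ ℓ → y ∈ ℓ → x ∈ m → y ∈ m → ℓ = m
  exists_line : ∀ {x y : V}, G.Adj x y → ∃ ℓ ∈ 𝓒, x ∈ ℓ ∧ y ∈ ℓ
  ncard_lines : ∀ x, {ℓ ∈ 𝓒 | x ∈ ℓ}.ncard = r
  ncard_neighbors : ∀ {ℓ}, ℓ ∈ 𝓒 → ∀ {u v : V}, u ∉ ℓ → v ∈ ℓ → G.Adj u v →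
    {w ∈ ℓ | G.Adj u w}.ncard = s + 1
  dualPasch : DualPasch G 𝓒

/-- `y` and `z` are adjacent neighbours of `x` on different lines through `x`. -/
structure IsTriangle {V : Type*} (G : SimpleGraph V) (𝓒 : Set (Set V)) (x y z : V) : Prop where
  adj_left : G.Adj x y
  adj_right : G.Adj x z
  adj : G.Adj y z
  notMem : ∀ ℓ ∈ 𝓒, x ∈ ℓ → y ∈ ℓ → z ∉ ℓ

section

variable {V : Type*} {G : SimpleGraph V} {𝓒 : Set (Set V)} {s r : ℕ} {x y z v w : V}
  {ℓ m M : Set V}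

theorem IsTriangle.symm (h : IsTriangle G 𝓒 x y z) : IsTriangle G 𝓒 x z y :=
  ⟨h.adj_right, h.adj_left, h.adj.symm, fun ℓ hℓ hx hz hy => h.notMem ℓ hℓ hx hy hz⟩

namespace IsDualPaschGeometry

theorem adj_of_mem (h : IsDualPaschGeometry G 𝓒 s r) (hℓ : ℓ ∈ 𝓒) (hy : y ∈ ℓ) (hz : z ∈ ℓ)
    (hyz : y ≠ z) : G.Adj y z :=
  h.isClique ℓ hℓ hy hz hyz

theorem isTriangle_of_notMem (h : IsDualPaschGeometry G 𝓒 s r) (hxy : G.Adj x y)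
    (hxz : G.Adj x z) (hyz : G.Adj y z) (hℓ : ℓ ∈ 𝓒) (hx : x ∈ ℓ) (hy : y ∈ ℓ) (hz : z ∉ ℓ) :
    IsTriangle G 𝓒 x y z :=
  ⟨hxy, hxz, hyz, fun _ hm hxm hym hzm =>
    hz (h.line_unique hxy.ne hm hℓ hxm hym hx hy ▸ hzm)⟩

theorem adj_of_isTriangle (h : IsDualPaschGeometry G 𝓒 s r) (hz : IsTriangle G 𝓒 x y z)
    (hw : IsTriangle G 𝓒 x y w) (hzw : z ≠ w) : G.Adj z w := by
  obtain ⟨ℓ, hℓ, hx, hy⟩ := h.exists_line hz.adj_left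
  exact h.dualPasch x y hz.adj_left ℓ hℓ hx hy
    ⟨hz.adj_right, hz.adj, hz.notMem ℓ hℓ hx hy⟩ ⟨hw.adj_right, hw.adj, hw.notMem ℓ hℓ hx hy⟩ hzw

theorem isTriangle_trans (h : IsDualPaschGeometry G 𝓒 s r) (hz : IsTriangle G 𝓒 x y z)
    (hw : IsTriangle G 𝓒 x y w) (hℓ : ℓ ∈ 𝓒) (hxℓ : x ∈ ℓ) (hzℓ : z ∈ ℓ) (hwℓ : w ∉ ℓ) :
    IsTriangle G 𝓒 x z w :=
  h.isTriangle_of_notMem hz.adj_right hw.adj_right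
    (h.adj_of_isTriangle hz hw fun e => hwℓ (e ▸ hzℓ)) hℓ hxℓ hzℓ hwℓ

/-- The other neighbours of `y` on a line through `x`. -/
theorem setOf_neighbors_eq (h : IsDualPaschGeometry G 𝓒 s r) (hxy : G.Adj x y) (hm : m ∈ 𝓒)
    (hx : x ∈ m) (hy : y ∉ m) :
    {w ∈ m | G.Adj y w} = insert x {w ∈ m | IsTriangle G 𝓒 x y w} := by
  ext w
  constructor
  · rintro ⟨hw, hyw⟩
    by_cases e : w = x
    · exact Or.inl e
    · exact Or.inr ⟨hw, (h.isTriangle_of_notMem (h.adj_of_mem hm hx hw (Ne.symm e)) hxy hyw.symm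
        hm hx hw hy).symm⟩
  · rintro (rfl | ⟨hw, ht⟩)
    · exact ⟨hx, hxy.symm⟩
    · exact ⟨hw, ht.adj⟩

theorem ncard_isTriangle [Finite V] (h : IsDualPaschGeometry G 𝓒 s r) (hxy : G.Adj x y)
    (hm : m ∈ 𝓒) (hx : x ∈ m) (hy : y ∉ m) : {w ∈ m | IsTriangle G 𝓒 x y w}.ncard = s := by
  have h1 := h.ncard_neighbors hm hy hx hxy.symm
  rw [h.setOf_neighbors_eq hxy hm hx hy, Set.ncard_insert_of_notMem] at h1
  · omega
  · exact fun hx' => hx'.2.adj_right.ne rfl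

theorem exists_isTriangle [Finite V] (h : IsDualPaschGeometry G 𝓒 s r) (hs : 0 < s)
    (hxy : G.Adj x y) (hm : m ∈ 𝓒) (hx : x ∈ m) (hy : y ∉ m) :
    ∃ w ∈ m, IsTriangle G 𝓒 x y w := by
  have h1 := h.ncard_isTriangle hxy hm hx hy
  obtain ⟨w, hw⟩ := (Set.ncard_pos (Set.toFinite _)).1 (h1 ▸ hs)
  exact ⟨w, hw⟩

theorem exists_third_line [Finite V] (h : IsDualPaschGeometry G 𝓒 s r) (hr : 3 ≤ r) (x : V)
    (ℓ m : Set V) : ∃ n ∈ 𝓒, x ∈ n ∧ n ≠ ℓ ∧ n ≠ m := by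
  by_contra! hc
  have : {n ∈ 𝓒 | x ∈ n} ⊆ {ℓ, m} := by
    rintro n ⟨hn, hx⟩
    by_cases e : n = ℓ
    · exact Or.inl e
    · exact Or.inr (hc n hn hx e)
  have h1 := (Set.ncard_le_ncard this (Set.toFinite _)).trans (Set.ncard_insert_le ℓ {m})
  rw [h.ncard_lines, Set.ncard_singleton] at h1
  omega

/-- When `v` is off the line `xz`, dual Pasch on the edge `xy` makes `x, z, v` a triangle; dual
Pasch on `xz` then joins `v` to `w`. -/
theorem isTriangle_of_collinear_aux (h : IsDualPaschGeometry G 𝓒 s r) (hℓ : ℓ ∈ 𝓒) (hx : x ∈ ℓ)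
    (hy : y ∈ ℓ) (hw : w ∈ ℓ) (hyz : IsTriangle G 𝓒 x y z) (hwz : IsTriangle G 𝓒 x w z)
    (hyv : IsTriangle G 𝓒 x y v) (hm : m ∈ 𝓒) (hxm : x ∈ m) (hzm : z ∈ m) (hvm : v ∉ m) :
    IsTriangle G 𝓒 x w v :=
  h.isTriangle_trans hwz.symm (h.isTriangle_trans hyz hyv hm hxm hzm hvm) hℓ hx hw
    (hyv.notMem ℓ hℓ hx hy)

/-- If `y` and `w` lie on one line through `x` and both form a triangle with `x` and some `z`, they
form triangles with the same points. -/
theorem isTriangle_of_collinear [Finite V] (h : IsDualPaschGeometry G 𝓒 s r) (hs : 0 < s)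
    (hr : 3 ≤ r) (hℓ : ℓ ∈ 𝓒) (hx : x ∈ ℓ) (hy : y ∈ ℓ) (hw : w ∈ ℓ)
    (hyz : IsTriangle G 𝓒 x y z) (hwz : IsTriangle G 𝓒 x w z) (hyv : IsTriangle G 𝓒 x y v) :
    IsTriangle G 𝓒 x w v := by
  obtain ⟨m, hm, hxm, hzm⟩ := h.exists_line hyz.adj_right
  by_cases hvm : v ∈ m
  -- If `v` is on the line `xz`, pass through a point `u` of a third line: the auxiliary lemma goes
  -- from `z` to `u`, then from `u` to `v`.
  · obtain ⟨n, hn, hxn, hnℓ, hnm⟩ := h.exists_third_line hr x ℓ m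
    have hyn : y ∉ n := fun e => hnℓ (h.line_unique hyz.adj_left.ne hn hℓ hxn e hx hy)
    obtain ⟨u, hun, hyu⟩ := h.exists_isTriangle hs hyz.adj_left hn hxn hyn
    have hum : u ∉ m := fun e => hnm (h.line_unique hyu.adj_right.ne hn hm hxn hun hxm e)
    have hvn : v ∉ n := fun e => hnm (h.line_unique hyv.adj_right.ne hn hm hxn e hxm hvm)
    have hwu := h.isTriangle_of_collinear_aux hℓ hx hy hw hyz hwz hyu hm hxm hzm hum
    exact h.isTriangle_of_collinear_aux hℓ hx hy hw hyu hwu hyv hn hxn hun hvn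
  · exact h.isTriangle_of_collinear_aux hℓ hx hy hw hyz hwz hyv hm hxm hzm hvm

/-! ### Assemblies -/

/-- A maximal clique contained in a line would equal that line. -/
theorem exists_isTriangle_of_isAssembly (h : IsDualPaschGeometry G 𝓒 s r) (hM : IsAssembly G 𝓒 M)
    (hℓ : ℓ ∈ 𝓒) (hxM : x ∈ M) (hx : x ∈ ℓ) : ∃ z ∈ M, z ∉ ℓ ∧ G.Adj x z := by
  by_contra! hc
  have hsub : M ⊆ ℓ := fun z hz => by
    by_contra hzℓ
    exact hc z hz hzℓ (hM.1.prop hxM hz fun e => hzℓ (e ▸ hx))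
  exact hM.2 (hM.1.eq_of_subset (h.isClique ℓ hℓ) hsub ▸ hℓ)

theorem mem_of_isTriangle [Finite V] (h : IsDualPaschGeometry G 𝓒 s r) (hs : 0 < s) (hr : 3 ≤ r)
    (hM : IsAssembly G 𝓒 M) (hx : x ∈ M) (hy : y ∈ M) (hyw : IsTriangle G 𝓒 x y w) : w ∈ M := by
  have hclique := hM.1.prop
  have hins : G.IsClique (insert w M) := by
    refine hclique.insert fun v hv hwv => ?_
    by_cases hvx : v = x
    · exact hvx ▸ hyw.adj_right.symm
    by_cases hvy : v = y
    · exact hvy ▸ hyw.adj.symm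
    have hxv : G.Adj x v := hclique hx hv (Ne.symm hvx)
    have hyv : G.Adj y v := hclique hy hv (Ne.symm hvy)
    obtain ⟨ℓ, hℓ, hxℓ, hyℓ⟩ := h.exists_line hyw.adj_left
    by_cases hvℓ : v ∈ ℓ
    -- Dual Pasch on `xy` says nothing about `v` on that line. A point `z` of `M` off the line forms
    -- triangles with both `y` and `v`, so the triangle with `w` transfers from `y` to `v`.
    · obtain ⟨z, hz, hzℓ, hxz⟩ := h.exists_isTriangle_of_isAssembly hM hℓ hx hxℓ
      have hyz := h.isTriangle_of_notMem hyw.adj_left hxz (hclique hy hz fun e => hzℓ (e ▸ hyℓ))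
        hℓ hxℓ hyℓ hzℓ
      have hvz := h.isTriangle_of_notMem hxv hxz (hclique hv hz fun e => hzℓ (e ▸ hvℓ))
        hℓ hxℓ hvℓ hzℓ
      exact (h.isTriangle_of_collinear hs hr hℓ hxℓ hyℓ hvℓ hyz hvz hyw).adj.symm
    · exact h.adj_of_isTriangle hyw
        (h.isTriangle_of_notMem hyw.adj_left hxv hyv hℓ hxℓ hyℓ hvℓ) hwv
  exact hM.1.le_of_ge hins (Set.subset_insert w M) (Set.mem_insert w M)

theorem ncard_line_inter_assembly [Finite V] (h : IsDualPaschGeometry G 𝓒 s r) (hs : 0 < s)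
    (hr : 3 ≤ r) (hM : IsAssembly G 𝓒 M) (hℓ : ℓ ∈ 𝓒) (hne : (ℓ ∩ M).Nonempty) :
    (ℓ ∩ M).ncard = s + 1 := by
  obtain ⟨x, hxℓ, hxM⟩ := hne
  obtain ⟨y, hy, hyℓ, hxy⟩ := h.exists_isTriangle_of_isAssembly hM hℓ hxM hxℓ
  rw [← h.ncard_neighbors hℓ hyℓ hxℓ hxy.symm]
  congr 1
  -- The points of `ℓ` in `M` are exactly the neighbours on `ℓ` of a point `y` of `M` off `ℓ`.
  ext w
  constructor
  · rintro ⟨hwℓ, hwM⟩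
    exact ⟨hwℓ, hM.1.prop hy hwM fun e => hyℓ (e ▸ hwℓ)⟩
  · intro hw
    refine ⟨hw.1, ?_⟩
    rw [h.setOf_neighbors_eq hxy hℓ hxℓ hyℓ] at hw
    rcases hw with rfl | ⟨-, ht⟩
    · exact hxM
    · exact h.mem_of_isTriangle hs hr hM hxM hy ht

/-- Two neighbours of `u` in `M` on different lines through `u` would form a triangle with `u` and
pull `u` into `M`. -/
theorem mem_of_adj_assembly [Finite V] (h : IsDualPaschGeometry G 𝓒 s r) (hs : 0 < s) (hr : 3 ≤ r)
    (hM : IsAssembly G 𝓒 M) {u : V} (hu : u ∉ M) (hv : v ∈ M) (huv : G.Adj u v) (hℓ : ℓ ∈ 𝓒)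
    (huℓ : u ∈ ℓ) (hvℓ : v ∈ ℓ) (hw : w ∈ M) (huw : G.Adj u w) : w ∈ ℓ := by
  by_contra hwℓ
  have hvw := hM.1.prop hv hw fun e => hwℓ (e ▸ hvℓ)
  exact hu (h.mem_of_isTriangle hs hr hM hv hw
    (h.isTriangle_of_notMem huv.symm hvw huw hℓ hvℓ huℓ hwℓ).symm)

theorem ncard_neighbors_in_assembly [Finite V] (h : IsDualPaschGeometry G 𝓒 s r) (hs : 0 < s)
    (hr : 3 ≤ r) (hM : IsAssembly G 𝓒 M) {u : V} (hu : u ∉ M) (hv : v ∈ M) (huv : G.Adj u v) :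
    {w | w ∈ M ∧ G.Adj u w}.ncard = s + 1 := by
  obtain ⟨ℓ, hℓ, huℓ, hvℓ⟩ := h.exists_line huv
  rw [← h.ncard_line_inter_assembly hs hr hM hℓ ⟨v, hvℓ, hv⟩]
  congr 1
  ext w
  constructor
  · rintro ⟨hw, huw⟩
    exact ⟨h.mem_of_adj_assembly hs hr hM hu hv huv hℓ huℓ hvℓ hw huw, hw⟩
  · rintro ⟨hwℓ, hw⟩
    exact ⟨hw, h.adj_of_mem hℓ huℓ hwℓ fun e => hu (e ▸ hw)⟩

theorem existsUnique_line_to_assembly [Finite V] (h : IsDualPaschGeometry G 𝓒 s r) (hs : 0 < s)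
    (hr : 3 ≤ r) (hM : IsAssembly G 𝓒 M) {u : V} (hu : u ∉ M) (hv : v ∈ M) (huv : G.Adj u v) :
    ∃! ℓ : Set V, ℓ ∈ 𝓒 ∧ u ∈ ℓ ∧ (ℓ ∩ M).Nonempty := by
  obtain ⟨ℓ, hℓ, huℓ, hvℓ⟩ := h.exists_line huv
  refine ⟨ℓ, ⟨hℓ, huℓ, v, hvℓ, hv⟩, ?_⟩
  rintro m ⟨hm, hum, w, hwm, hw⟩
  have huw : u ≠ w := fun e => hu (e ▸ hw)
  exact h.line_unique huw hm hℓ hum hwm huℓ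
    (h.mem_of_adj_assembly hs hr hM hu hv huv hℓ huℓ hvℓ hw (h.adj_of_mem hm hum hwm huw))

/-! ### The local graph -/

/-- The line through `x` and a neighbour of `x`. -/
noncomputable def lineOf (h : IsDualPaschGeometry G 𝓒 s r) (x : V) (y : G.neighborSet x) :
    {ℓ : Set V // ℓ ∈ 𝓒 ∧ x ∈ ℓ} :=
  ⟨(h.exists_line y.2).choose, (h.exists_line y.2).choose_spec.1,
    (h.exists_line y.2).choose_spec.2.1⟩

theorem mem_lineOf (h : IsDualPaschGeometry G 𝓒 s r) (x : V) (y : G.neighborSet x) :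
    (y : V) ∈ (h.lineOf x y).1 :=
  (h.exists_line y.2).choose_spec.2.2

theorem lineOf_eq_iff (h : IsDualPaschGeometry G 𝓒 s r) {x : V} {y : G.neighborSet x}
    {ℓ : {ℓ : Set V // ℓ ∈ 𝓒 ∧ x ∈ ℓ}} : h.lineOf x y = ℓ ↔ (y : V) ∈ ℓ.1 :=
  ⟨fun e => e ▸ h.mem_lineOf x y, fun hy => Subtype.ext <|
    h.line_unique y.2.ne (h.lineOf x y).2.1 ℓ.2.1 (h.lineOf x y).2.2 (h.mem_lineOf x y) ℓ.2.2 hy⟩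

theorem isTriangle_iff (h : IsDualPaschGeometry G 𝓒 s r) {x : V} {y z : G.neighborSet x} :
    IsTriangle G 𝓒 x y z ↔ G.Adj y z ∧ h.lineOf x y ≠ h.lineOf x z := by
  constructor
  · refine fun ht => ⟨ht.adj, fun e => ?_⟩
    exact ht.notMem _ (h.lineOf x y).2.1 (h.lineOf x y).2.2 (h.mem_lineOf x y)
      (e ▸ h.mem_lineOf x z)
  · rintro ⟨hadj, hne⟩
    refine h.isTriangle_of_notMem y.2 z.2 hadj (h.lineOf x y).2.1 (h.lineOf x y).2.2
      (h.mem_lineOf x y) fun hz => hne ?_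
    exact (h.lineOf_eq_iff.2 hz).symm

theorem isTriangle_congr [Finite V] (h : IsDualPaschGeometry G 𝓒 s r) (hs : 0 < s) (hr : 3 ≤ r)
    {x : V} {y w z : G.neighborSet x} (he : h.lineOf x y = h.lineOf x w)
    (hyz : IsTriangle G 𝓒 x y z) (hwz : IsTriangle G 𝓒 x w z) (v : V) :
    IsTriangle G 𝓒 x y v ↔ IsTriangle G 𝓒 x w v :=
  ⟨h.isTriangle_of_collinear hs hr (h.lineOf x y).2.1 (h.lineOf x y).2.2 (h.mem_lineOf x y)
    (he ▸ h.mem_lineOf x w) hyz hwz,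
  h.isTriangle_of_collinear hs hr (h.lineOf x y).2.1 (h.lineOf x y).2.2 (he ▸ h.mem_lineOf x w)
    (h.mem_lineOf x y) hwz hyz⟩

/-- Two neighbours of `x` are related if they lie on the same assemblies through `x`. -/
def assemblySetoid [Finite V] (h : IsDualPaschGeometry G 𝓒 s r) (hs : 0 < s) (hr : 3 ≤ r) (x : V) :
    Setoid (G.neighborSet x) where
  -- Points on one line through `x` are always adjacent or equal, so there the triangles they form
  -- are compared instead.
  r y z := IsTriangle G 𝓒 x y z ∨ (h.lineOf x y = h.lineOf x z ∧
    ∀ v, IsTriangle G 𝓒 x y v ↔ IsTriangle G 𝓒 x z v)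
  iseqv := by
    refine ⟨fun y => Or.inr ⟨rfl, fun _ => Iff.rfl⟩, ?_, ?_⟩
    · rintro y z (ht | ⟨he, hv⟩)
      · exact Or.inl ht.symm
      · exact Or.inr ⟨he.symm, fun v => (hv v).symm⟩
    · rintro y z w (ht | ⟨he, hv⟩) (ht' | ⟨he', hv'⟩)
      -- If `y` and `w` are on one line through `x`, they share the triangle partner `z`, hence all
      -- partners; otherwise dual Pasch on `xz` joins them.
      · by_cases e : h.lineOf x y = h.lineOf x w
        · exact Or.inr ⟨e, h.isTriangle_congr hs hr e ht ht'.symm⟩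
        · refine Or.inl (h.isTriangle_trans ht.symm ht' (h.lineOf x y).2.1 (h.lineOf x y).2.2
            (h.mem_lineOf x y) fun hw => e ?_)
          exact (h.lineOf_eq_iff.2 hw).symm
      · exact Or.inl ((hv' y).1 ht.symm).symm
      · exact Or.inl ((hv w).2 ht')
      · exact Or.inr ⟨he.trans he', fun v => (hv v).trans (hv' v)⟩

theorem adj_iff [Finite V] (h : IsDualPaschGeometry G 𝓒 s r) (hs : 0 < s) (hr : 3 ≤ r) {x : V}
    {y z : G.neighborSet x} : G.Adj y z ↔ y ≠ z ∧
      (Quotient.mk (h.assemblySetoid hs hr x) y = Quotient.mk (h.assemblySetoid hs hr x) z ∨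
        h.lineOf x y = h.lineOf x z) := by
  rw [Quotient.eq]
  constructor
  · intro hadj
    refine ⟨fun e => hadj.ne (congrArg _ e), ?_⟩
    by_cases e : h.lineOf x y = h.lineOf x z
    · exact Or.inr e
    · exact Or.inl (Or.inl (h.isTriangle_iff.2 ⟨hadj, e⟩))
  · have hline : y ≠ z → h.lineOf x y = h.lineOf x z → G.Adj (y : V) z := fun hne e =>
      h.adj_of_mem (h.lineOf x y).2.1 (h.mem_lineOf x y) (e ▸ h.mem_lineOf x z)
        fun e => hne (Subtype.ext e)
    rintro ⟨hne, (ht | ⟨e, -⟩) | e⟩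
    · exact ht.adj
    · exact hline hne e
    · exact hline hne e

theorem card_fiber [Finite V] (h : IsDualPaschGeometry G 𝓒 s r) (hs : 0 < s) (hr : 3 ≤ r) (x : V)
    (p : Quotient (h.assemblySetoid hs hr x) × {ℓ : Set V // ℓ ∈ 𝓒 ∧ x ∈ ℓ}) :
    Nat.card {y : G.neighborSet x //
      (Quotient.mk (h.assemblySetoid hs hr x) y, h.lineOf x y) = p} = s := by
  obtain ⟨q, ℓ⟩ := p
  -- For a representative `y` off `ℓ`, the fibre is the set of points of `ℓ` forming a triangle with
  -- `x` and `y`: its `s + 1` neighbours there, without `x`.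
  have aux : ∀ y : G.neighborSet x, h.lineOf x y ≠ ℓ →
      Quotient.mk (h.assemblySetoid hs hr x) y = q →
      Nat.card {z : G.neighborSet x //
        (Quotient.mk (h.assemblySetoid hs hr x) z, h.lineOf x z) = (q, ℓ)} = s := by
    rintro y hy rfl
    refine Eq.trans ?_ (h.ncard_isTriangle y.2 ℓ.2.1 ℓ.2.2 fun e => hy (h.lineOf_eq_iff.2 e))
    rw [← Nat.card_coe_set_eq]
    refine Nat.card_congr
      { toFun := fun z => ⟨z.1, ?_⟩
        invFun := fun z => ⟨⟨z.1, z.2.2.adj_right⟩, ?_⟩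
        left_inv := fun _ => rfl
        right_inv := fun _ => rfl }
    · have h1 := (Prod.ext_iff.1 z.2).1
      have h2 : h.lineOf x z.1 = ℓ := (Prod.ext_iff.1 z.2).2
      refine ⟨h.lineOf_eq_iff.1 h2, ?_⟩
      rcases Quotient.eq.1 h1 with ht | ⟨e, -⟩
      · exact ht.symm
      · exact absurd (e.symm.trans h2) hy
    · refine Prod.ext (Quotient.eq.2 (Or.inl z.2.2.symm)) (h.lineOf_eq_iff.2 z.2.1)
  obtain ⟨y, rfl⟩ := Quotient.exists_rep q
  by_cases hy : h.lineOf x y = ℓ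
  -- A representative on `ℓ` is replaced by an equivalent one on another line through `x`.
  · obtain ⟨m, hm, hxm, hmℓ, -⟩ := h.exists_third_line hr x ℓ ℓ
    have hym : (y : V) ∉ m := fun e => hmℓ <| by
      rw [← hy, h.lineOf_eq_iff (ℓ := ⟨m, hm, hxm⟩) |>.2 e]
    obtain ⟨z, hzm, hz⟩ := h.exists_isTriangle hs y.2 hm hxm hym
    refine aux ⟨z, hz.adj_right⟩ (fun e => hmℓ ?_) (Quotient.eq.2 (Or.inl hz.symm))
    rw [← e, h.lineOf_eq_iff (ℓ := ⟨m, hm, hxm⟩) |>.2 hzm]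
  · exact aux y hy rfl

end IsDualPaschGeometry

/-- A graph on a finite type with two projections whose joint fibres all have `s` elements, in which
adjacency means agreeing in a projection, is a clique extension of a grid. -/
theorem nonempty_iso_cliqueExtension_grid {T A B : Type*} [Finite T] [Finite A] [Finite B]
    (H : SimpleGraph T) (f : T → A) (g : T → B)
    (hadj : ∀ y z, H.Adj y z ↔ y ≠ z ∧ (f y = f z ∨ g y = g z))
    (hfib : ∀ p : A × B, Nat.card {y // (f y, g y) = p} = s) :
    Nonempty (H ≃g cliqueExtension s (grid (Nat.card A) (Nat.card B))) := by
  let eA := Finite.equivFin A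
  let eB := Finite.equivFin B
  let eF : ∀ p : A × B, {y // (f y, g y) = p} ≃ Fin s := fun p => Finite.equivFinOfCardEq (hfib p)
  let e : T ≃ (Fin (Nat.card A) × Fin (Nat.card B)) × Fin s :=
    (Equiv.sigmaFiberEquiv fun y => (f y, g y)).symm.trans <|
      (Equiv.sigmaCongrRight eF).trans <| (Equiv.sigmaEquivProd _ _).trans <|
        (eA.prodCongr eB).prodCongr (Equiv.refl _)
  have he1 : ∀ y, (e y).1 = (eA (f y), eB (g y)) := fun y => rfl
  refine ⟨⟨e, ?_⟩⟩
  intro y z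
  rw [hadj]
  have hne : y ≠ z ↔ ¬((e y).1 = (e z).1 ∧ (e y).2 = (e z).2) := by
    rw [← Prod.ext_iff, e.injective.eq_iff]
  simp only [cliqueExtension, grid, SimpleGraph.boxProd_adj, SimpleGraph.top_adj]
  rw [hne, he1, he1, Prod.mk.injEq, eA.injective.eq_iff, eB.injective.eq_iff]
  simp only [ne_eq, eA.injective.eq_iff, eB.injective.eq_iff]
  tauto

theorem IsDualPaschGeometry.exists_localGraph_iso [Finite V] (h : IsDualPaschGeometry G 𝓒 s r)
    (hs : 0 < s) (hr : 3 ≤ r) (x : V) : ∃ m : ℕ,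
      Nonempty (localGraph G x ≃g cliqueExtension s (grid m r)) := by
  have hcard : Nat.card {ℓ : Set V // ℓ ∈ 𝓒 ∧ x ∈ ℓ} = r := h.ncard_lines x
  refine ⟨Nat.card (Quotient (h.assemblySetoid hs hr x)), ?_⟩
  have := nonempty_iso_cliqueExtension_grid (localGraph G x)
    (Quotient.mk (h.assemblySetoid hs hr x)) (h.lineOf x)
    (fun y z => by rw [← h.adj_iff hs hr]; rfl) (h.card_fiber hs hr x)
  rwa [hcard] at this

end

end ClassicalDRG

/-! ### Passage from the spectral data to the dual Pasch geometry. -/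

theorem theorem24 {V : Type*} [Fintype V] [DecidableEq V] (G : SimpleGraph V) [DecidableRel G.Adj]
    (D : ℕ) (b α β : ℝ) (hD : 3 ≤ D) (hb : 2 ≤ b) (hα1 : 1 ≤ α) (hαb : α ≤ b - 1)
    (hG : ClassicalDRG.HasClassicalParameters G D b α β)
    (hgeom : ClassicalDRG.IsGeometric G)
    (𝓒 : Set (Set V))
    (hDel : ∀ C ∈ 𝓒, ClassicalDRG.IsDelsarteClique G C)
    (hPLS : ClassicalDRG.IsPartialLinearSpace 𝓒)
    (hpt : ClassicalDRG.IsPointGraph G 𝓒)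
    (hDP : ClassicalDRG.DualPasch G 𝓒) :
    (∀ ℓ ∈ 𝓒, ∀ M : Set V, ClassicalDRG.IsAssembly G 𝓒 M →
      (ℓ ∩ M).Nonempty → ((ℓ ∩ M).ncard : ℝ) = α + 1) ∧
    (∀ M : Set V, ClassicalDRG.IsAssembly G 𝓒 M → ∀ u : V, u ∉ M → (∃ v ∈ M, G.Adj u v) →
      ({v : V | v ∈ M ∧ G.Adj u v}.ncard : ℝ) = α + 1 ∧
      ∃! ℓ : Set V, ℓ ∈ 𝓒 ∧ u ∈ ℓ ∧ (ℓ ∩ M).Nonempty) ∧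
    (∃ s m r : ℕ, (s : ℝ) = α ∧ (m : ℝ) = β / α ∧ (r : ℝ) = ClassicalDRG.gaussNum b D ∧
      ∀ x : V, Nonempty (ClassicalDRG.localGraph G x ≃g
        ClassicalDRG.cliqueExtension s (ClassicalDRG.grid m r))) := by
  open ClassicalDRG in
  obtain ⟨bs, cs, h⟩ := hG.exists_numbers
  have hb0 : 0 < b := by linarith
  have hα0 : 0 ≤ α := by linarith
  have hlines := h.ncard_lines hb0 hα0 (by omega) hDel hPLS hpt
  have hnbrs := fun {ℓ : Set V} (hℓ : ℓ ∈ 𝓒) {u v : V} =>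
    h.ncard_neighbors_on_line hb0 hα0 (by omega) hDel hPLS hpt hℓ (u := u) (v := v)
  obtain ⟨x₀⟩ := hPLS.points_nonempty
  obtain ⟨r, hr⟩ : ∃ r : ℕ, (r : ℝ) = gaussNum b D := ⟨_, hlines x₀⟩
  have hr3 : 3 ≤ r := by
    have h1 := (gaussNum_strictMono hb0).monotone hD
    have h2 : gaussNum b 3 = 1 + b + b ^ 2 := by simp [gaussNum, Finset.sum_range_succ]
    have : (3 : ℝ) ≤ r := by nlinarith
    exact_mod_cast this
  have hr1 : 1 < gaussNum b D := by
    rw [← hr]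
    exact_mod_cast (by omega : 1 < r)
  have hβ : 0 < β := by simpa [gaussNum_zero] using h.sub_pos hb0 (j := 0) (by omega)
  have hdeg : ∀ x, (G.degree x : ℝ) = r * β := fun x => by
    rw [h.reg.degree_eq, h.b_eq 0 (Nat.zero_le _), gaussNum_zero, hr]
    ring
  have hcl : ∀ ℓ ∈ 𝓒, G.IsClique ℓ := fun ℓ hℓ => (hDel ℓ hℓ).1
  obtain ⟨s, hs⟩ : ∃ s : ℕ, (s : ℝ) = α := by
    -- Integrality of `α` needs an actual point off a line with a neighbour on it: take `x` and `z`
    -- at distance `2`, a common neighbour `y`, and the line `yz`.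
    obtain ⟨x, z, hxz⟩ := h.exists_dist 2 (by omega)
    obtain ⟨p, hp⟩ := h.reg.connected.exists_walk_length_eq_dist x z
    rw [hxz] at hp
    obtain ⟨y, hxy, hyz⟩ : ∃ y, G.Adj x y ∧ G.Adj y z := by
      cases p with
      | nil => simp at hp
      | cons hxy q =>
        refine ⟨_, hxy, SimpleGraph.Walk.adj_of_length_eq_one (p := q) ?_⟩
        simpa using hp
    obtain ⟨-, ℓ, hℓ, hyℓ, hzℓ⟩ := (hpt y z).1 hyz
    have hxℓ : x ∉ ℓ := fun hx => by
      have hadj := hcl ℓ hℓ hx hzℓ fun e => by simp [e] at hxz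
      rw [SimpleGraph.dist_eq_one_iff_adj.2 hadj] at hxz
      omega
    have hcard := hnbrs hℓ hxℓ hyℓ hxy
    refine ⟨{w ∈ ℓ | G.Adj x w}.ncard - 1, ?_⟩
    rw [Nat.cast_sub, hcard]
    · simp
    · have : (1 : ℝ) ≤ ({w ∈ ℓ | G.Adj x w}.ncard : ℝ) := by linarith
      exact_mod_cast this
  have hs0 : 0 < s := by
    have : (0 : ℝ) < s := by linarith
    exact_mod_cast this
  have hgeo : IsDualPaschGeometry G 𝓒 s r :=
    { isClique := hcl
      line_unique := fun hxy _ _ hℓ hm => hPLS.line_unique _ _ hxy _ hℓ _ hm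
      exists_line := fun hadj => ((hpt _ _).1 hadj).2
      ncard_lines := fun x => by exact_mod_cast (hlines x).trans hr.symm
      ncard_neighbors := fun hℓ u v hu hv huv => by
        have := hnbrs hℓ hu hv huv
        rw [← hs] at this
        exact_mod_cast this
      dualPasch := hDP }
  refine ⟨fun ℓ hℓ M hM hne => ?_, fun M hM u hu hv => ?_, ?_⟩
  · rw [hgeo.ncard_line_inter_assembly hs0 hr3 hM hℓ hne, ← hs]
    push_cast
    rfl
  · obtain ⟨v, hv, huv⟩ := hv
    refine ⟨?_, hgeo.existsUnique_line_to_assembly hs0 hr3 hM hu hv huv⟩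
    rw [hgeo.ncard_neighbors_in_assembly hs0 hr3 hM hu hv huv, ← hs]
    push_cast
    rfl
  · have hm : ∀ x, ∃ m : ℕ, (m : ℝ) = β / α ∧
        Nonempty (localGraph G x ≃g cliqueExtension s (grid m r)) := by
      intro x
      obtain ⟨m, ⟨e⟩⟩ := hgeo.exists_localGraph_iso hs0 hr3 x
      refine ⟨m, ?_, ⟨e⟩⟩
      -- Comparing cardinalities gives `m r s = r β`; hence `m = β / α`, which also makes `m`
      -- independent of `x`.
      have hc := Nat.card_congr e.toEquiv
      rw [Nat.card_eq_fintype_card, SimpleGraph.card_neighborSet_eq_degree] at hc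
      simp only [Nat.card_prod, Nat.card_fin] at hc
      have hd := hdeg x
      rw [hc] at hd
      push_cast at hd
      have hr0 : (r : ℝ) ≠ 0 := by rw [hr]; linarith
      rw [hs] at hd
      rw [eq_div_iff (by linarith)]
      refine mul_left_cancel₀ hr0 ?_
      linear_combination hd
    obtain ⟨m, hm0, -⟩ := hm x₀
    refine ⟨s, m, r, hs, hm0, hr, fun x => ?_⟩
    obtain ⟨m', hm', e⟩ := hm x
    have : m' = m := by exact_mod_cast hm'.trans hm0.symm
    exact this ▸ e
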